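/- Let $r\ge 0$, let $I\subseteq R:=\mathbb{C}[z_1^{\pm1},\dots,z_r^{\pm1}]$ be an ideal, and let $a\in\mathbb{R}^r$. The amoeba of $I$ is $\mathcal{A}_I=\mathrm{Log}(V(I))$, where $V(I)\subseteq(\mathbb{C}^*)^r$ is the zero locus of $I$ and $\mathrm{Log}(z)=(\log|z_1|,\dots,\log|z_r|)$. For $g=\sum_m c_m z^m\in R$ let $g\{a\}$ be the list (with multiplicities) of the positive numbers $|c_m|\,e^{m_1a_1+\cdots+m_ra_r}$, one for each exponent $m\in\mathbb{Z}^r$ with $c_m\neq0$. A list of positive numbers is lopsided if one of its entries is greater than the sum of all the others; a list with $d+1$ entries ($d\ge 0$) is superlopsided if one of its entries is greater than $d$ times each of the others (so a list with exactly one entry is superlopsided, and the empty list is neither lopsided nor superlopsided). Then: 1. $a\in\mathcal{A}_I$ if and only if $g\{a\}$ is not lopsided for every $g\in I$. 2. $a\in\mathcal{A}_I$ if and only if $g\{a\}$ is not superlopsided for every $g\in I$. 3. Suppose $a\notin\mathcal{A}_I$ and $I=\langle f_1,\dots,f_k\rangle$. Put $$f_a(z)=\sum_{j=1}^k f_j(z_1,\dots,z_r)\,\bar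 f_j\big(e^{2a_1}z_1^{-1},\dots,e^{2a_r}z_r^{-1}\big),$$ where $\bar f_j$ is obtained from $f_j$ by conjugating the coefficients, and for $n\ge1$ let $$g_n(z)=\prod_{k_1=0}^{n-1}\cdots\prod_{k_r=0}^{n-1}f_a\big(e^{2\pi i k_1/n}z_1,\dots,e^{2\pi i k_r/n}z_r\big)$$ be its cyclic resultant. Then there is $N$ such that for all $n\ge N$ one has $g_n\in I$, and the list $g_n\{a\}$ is both lopsided and superlopsided. -/

import Mathlib

namespace Amoeba

noncomputable section

/-- The Laurent polynomial ring `ℂ[z₁^{±1}, …, z_r^{±1}]`: the monoid algebra of the group `ℤ^r`,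
where the exponent vector `m` stands for the monomial `z₁^{m₁} ⋯ z_r^{m_r}`. -/
abbrev Laurent (r : ℕ) : Type := AddMonoidAlgebra ℂ (Fin r → ℤ)

/-- The group homomorphism `m ↦ w₁^{m₁} ⋯ w_r^{m_r}` attached to units `w₁, …, w_r`. -/
def monomialHom {r : ℕ} {A : Type*} [CommRing A] (w : Fin r → Aˣ) :
    Multiplicative (Fin r → ℤ) →* A where
  toFun m := ((∏ i, w i ^ (m.toAdd i) : Aˣ) : A)
  map_one' := by simp
  map_mul' m m' := by simp [zpow_add, Finset.prod_mul_distrib]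

/-- Substitution `f ↦ f(w₁, …, w_r)` of units `w₁, …, w_r` of a commutative `ℂ`-algebra `A` for the
variables of a Laurent polynomial. -/
def subst {r : ℕ} {A : Type*} [CommRing A] [Algebra ℂ A] (w : Fin r → Aˣ) : Laurent r →ₐ[ℂ] A :=
  AddMonoidAlgebra.lift ℂ A (Fin r → ℤ) (monomialHom w)

/-- The variable `z_i`, as a unit of the Laurent polynomial ring. -/
def X {r : ℕ} (i : Fin r) : (Laurent r)ˣ where
  val := AddMonoidAlgebra.single (Pi.single i 1) 1
  inv := AddMonoidAlgebra.single (-Pi.single i 1) 1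
  val_inv := by simp [AddMonoidAlgebra.single_mul_single, AddMonoidAlgebra.one_def]
  inv_val := by simp [AddMonoidAlgebra.single_mul_single, AddMonoidAlgebra.one_def]

/-- A nonzero complex number, as a unit of the Laurent polynomial ring. -/
def const {r : ℕ} (t : ℂˣ) : (Laurent r)ˣ := Units.map (algebraMap ℂ (Laurent r)).toMonoidHom t

/-- `Log : (ℂ^*)^r → ℝ^r`, `(z₁, …, z_r) ↦ (log|z₁|, …, log|z_r|)`. -/
def Log {r : ℕ} (z : Fin r → ℂˣ) : Fin r → ℝ := fun i => Real.log ‖(z i : ℂ)‖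

/-- The zero locus `V(I) ⊆ (ℂ^*)^r` of an ideal. -/
def zeroLocus {r : ℕ} (I : Ideal (Laurent r)) : Set (Fin r → ℂˣ) :=
  {z | ∀ f ∈ I, subst z f = 0}

/-- The amoeba of an ideal, `Log (V(I))`. -/
def amoeba {r : ℕ} (I : Ideal (Laurent r)) : Set (Fin r → ℝ) := Log '' zeroLocus I

/-- The list `f{a}` of the absolute values on `Log⁻¹(a)` of the monomials `c z^m` of `f`, one entry
for each exponent `m` whose coefficient `c` is nonzero. Entries may coincide, so this is a multiset.
On `Log⁻¹(a)` one has `|z_i| = e^{a_i}`, whence `|c z^m| = |c| ∏ (e^{a_i})^{m_i}`. -/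
def termList {r : ℕ} (f : Laurent r) (a : Fin r → ℝ) : Multiset ℝ :=
  f.coeff.support.val.map fun m => ‖f.coeff m‖ * ∏ i, Real.exp (a i) ^ (m i)

/-- The entries of `termList f a` are the absolute values of the monomials of `f` at any point
`z` with `Log z = a`. -/
theorem termList_Log {r : ℕ} (f : Laurent r) (z : Fin r → ℂˣ) :
    termList f (Log z) = f.coeff.support.val.map fun m =>
      ‖subst z (AddMonoidAlgebra.single m (f.coeff m))‖ := by
  unfold termList
  congr 1
  funext m
  simp [subst, monomialHom, Log, Real.exp_log]

/-- A list of positive numbers is lopsided if one entry is greater than the sum of all others. -/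
def IsLopsided (S : Multiset ℝ) : Prop :=
  ∃ (b : ℝ) (T : Multiset ℝ), S = b ::ₘ T ∧ T.sum < b

/-- A list of `d + 1` positive numbers is superlopsided if one entry is greater than `d` times
each of the others. -/
def IsSuperlopsided (S : Multiset ℝ) : Prop :=
  ∃ (b : ℝ) (T : Multiset ℝ), S = b ::ₘ T ∧ ∀ c ∈ T, (Multiset.card T : ℝ) * c < b

/-- The `n`-th root of unity `e^{2πi k/n}`, as a unit of `ℂ`. -/
def rootUnit (n k : ℕ) : ℂˣ :=
  Units.mk0 (Complex.exp (2 * Real.pi * Complex.I * k / n)) (Complex.exp_ne_zero _)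

/-- The cyclic resultant: the product over all `0 ≤ k₁, …, k_r ≤ n - 1` of
`f(e^{2πi k₁/n} z₁, …, e^{2πi k_r/n} z_r)`. -/
def cyclicResultant {r : ℕ} (n : ℕ) (f : Laurent r) : Laurent r :=
  ∏ k : Fin r → Fin n, subst (fun i => const (rootUnit n (k i)) * X i) f

/-- The Laurent polynomial `f̄` whose coefficients are the complex conjugates of those of `f`. -/
def conjCoeff {r : ℕ} (f : Laurent r) : Laurent r :=
  AddMonoidAlgebra.mapRingHom (Fin r → ℤ) (starRingEnd ℂ) f

/-- `∑_j f_j(z₁, …, z_r) f̄_j(e^{2a₁} z₁⁻¹, …, e^{2a_r} z_r⁻¹)`, which agrees with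
`∑_j |f_j(z)|²` on `Log⁻¹(a)`. -/
def sumOfSquares {r k : ℕ} (f : Fin k → Laurent r) (a : Fin r → ℝ) : Laurent r :=
  ∑ j, f j * subst
    (fun i => const (Units.mk0 (Complex.exp (2 * a i)) (Complex.exp_ne_zero _)) * (X i)⁻¹)
    (conjCoeff (f j))

end

end Amoeba

namespace Amoeba

variable {r : ℕ}

/-! If `g` vanishes at `z`, its monomials at `z` sum to zero, so by the triangle inequality none
exceeds the sum of the others (`not_isLopsided_of_subst_eq_zero`); superlopsided lists of positive
numbers are lopsided.

Conversely, let `a` lie outside the amoeba. On the compact torus `Log⁻¹(a)` the polynomial `p = f_a`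
equals `∑ |f_j|²`, so `0 < α ≤ p ≤ β` there. The logarithm of its cyclic resultant is the sum of
`log p` over `n`-torsion translates. Expand `log (p / β)` in powers of `u = 1 - p / β ∈ [0, ρ]`,
where `ρ = 1 - α / β < 1`. As long as a power of `u` has exponents below `n`, its sum over
translates is `n ^ r` times its constant coefficient, independent of the point. About `n / D` powers
qualify, where `D` bounds the exponents of `p`, so the resultant is a constant `M` up to a relative
error of order `n ^ r * ρ ^ (n / D)` (`exists_norm_cyclicResultant_sub_le`). Cauchy's estimate turns
this into a bound on every nonconstant monomial. The number of monomials grows only polynomially in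
`n`, so the constant term eventually wins. -/

/-! ### Substitution and rescaling of variables. -/

theorem subst_single {A : Type*} [CommRing A] [Algebra ℂ A] (w : Fin r → Aˣ) (m : Fin r → ℤ)
    (c : ℂ) : subst w (AddMonoidAlgebra.single m c) = c • ((∏ i, w i ^ m i : Aˣ) : A) := by
  simp [subst, monomialHom]

theorem subst_eq_sum (z : Fin r → ℂˣ) (f : Laurent r) :
    subst z f = ∑ m ∈ f.coeff.support, f.coeff m * ∏ i, (z i : ℂ) ^ m i := by
  conv_lhs => rw [← AddMonoidAlgebra.sum_coeff_single f]
  simp [Finsupp.sum, map_sum, subst_single]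

/-- Algebra homomorphisms commute with substitution. -/
theorem map_subst {A B : Type*} [CommRing A] [Algebra ℂ A] [CommRing B] [Algebra ℂ B]
    (φ : A →ₐ[ℂ] B) (w : Fin r → Aˣ) (f : Laurent r) :
    φ (subst w f) = subst (fun i => Units.map φ.toMonoidHom (w i)) f := by
  induction f using AddMonoidAlgebra.induction_linear with
  | zero => simp
  | add f g hf hg => simp [hf, hg]
  | single m c =>
    simp only [subst_single, map_smul]
    congr 1
    have := map_prod (Units.map φ.toMonoidHom) (fun i => w i ^ m i) Finset.univ
    simp only [map_zpow] at this
    rw [← this]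
    rfl

theorem subst_X (z : Fin r → ℂˣ) (i : Fin r) : subst z (X i : Laurent r) = z i := by
  simp only [X, subst_single, one_smul]
  rw [Finset.prod_eq_single i (by intro j _ hj; simp [hj]) (by simp)]
  simp

theorem unitsMap_subst_X (z : Fin r → ℂˣ) (i : Fin r) :
    Units.map (subst z).toMonoidHom (X i) = z i :=
  Units.ext (subst_X z i)

theorem unitsMap_subst_const (z : Fin r → ℂˣ) (t : ℂˣ) :
    Units.map (subst z).toMonoidHom (const t) = t :=
  Units.ext ((subst z).commutes (t : ℂ))

theorem subst_subst_const_mul_X (z : Fin r → ℂˣ) (t : Fin r → ℂˣ) (f : Laurent r) :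
    subst z (subst (fun i => const (t i) * X i) f) = subst (fun i => t i * z i) f := by
  rw [map_subst]
  simp only [map_mul, unitsMap_subst_X, unitsMap_subst_const]

/-- Rescaling the variables changes coefficients but not exponents, so torsion translates of a
Laurent polynomial obey the same exponent bounds. -/
theorem subst_const_mul_X_single (t : Fin r → ℂˣ) (m : Fin r → ℤ) (c : ℂ) :
    (subst (fun i => const (t i) * X i) (AddMonoidAlgebra.single m c) : Laurent r) =
      AddMonoidAlgebra.single m (c * ∏ i, (t i : ℂ) ^ m i) := by
  have hX : ∀ (n : ℤ) (i : Fin r), ((X i ^ n : (Laurent r)ˣ) : Laurent r) =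
      AddMonoidAlgebra.single (Pi.single i n) 1 := by
    intro n i
    have hnat : ∀ k : ℕ, ((X i ^ k : (Laurent r)ˣ) : Laurent r) =
        AddMonoidAlgebra.single (Pi.single i (k : ℤ)) 1 := by
      intro k
      rw [Units.val_pow_eq_pow_val]
      simp only [X, AddMonoidAlgebra.single_pow, one_pow]
      congr 1
      rw [← Pi.single_smul]
      simp
    obtain ⟨k, rfl | rfl⟩ := n.eq_nat_or_neg
    · exact_mod_cast hnat k
    · rw [zpow_neg, zpow_natCast, Units.inv_eq_of_mul_eq_one_right]
      rw [hnat, AddMonoidAlgebra.single_mul_single, AddMonoidAlgebra.one_def]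
      simp [← Pi.single_add]
  have hprod : ∀ s : Finset (Fin r),
      ∏ i ∈ s, (AddMonoidAlgebra.single (Pi.single i (m i)) 1 : Laurent r) =
        AddMonoidAlgebra.single (∑ i ∈ s, Pi.single i (m i)) 1 := by
    intro s
    induction s using Finset.induction_on with
    | empty => simp [AddMonoidAlgebra.one_def]
    | insert i s hi ih => simp [Finset.prod_insert hi, Finset.sum_insert hi, ih,
        AddMonoidAlgebra.single_mul_single]
  rw [subst_single]
  simp only [mul_zpow, Finset.prod_mul_distrib, Units.val_mul, Units.coe_prod, hX, hprod]
  rw [Finset.univ_sum_single]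
  have hc : ∀ i, ((const (t i) ^ m i : (Laurent r)ˣ) : Laurent r) =
      algebraMap ℂ (Laurent r) ((t i : ℂ) ^ m i) := by
    intro i
    have := Units.coe_map (algebraMap ℂ (Laurent r)).toMonoidHom (t i ^ m i)
    rw [const, ← map_zpow, this, Units.val_zpow_eq_zpow_val]
    rfl
  simp only [hc, ← map_prod]
  rw [← Algebra.smul_def, smul_smul, AddMonoidAlgebra.smul_single]
  simp

/-! ### Exponent boxes and the number of monomials. -/

/-- All exponents of `f` lie in the box `[-D, D]^r`. -/
def ExponentsLE (f : Laurent r) (D : ℕ) : Prop :=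
  ∀ m ∈ f.coeff.support, ∀ i, |m i| ≤ (D : ℤ)

theorem exists_exponentsLE (f : Laurent r) : ∃ D : ℕ, ExponentsLE f D := by
  refine ⟨∑ m ∈ f.coeff.support, ∑ i, (m i).natAbs, fun m hm i => ?_⟩
  rw [Int.abs_eq_natAbs, Nat.cast_le]
  exact (Finset.single_le_sum (f := fun i => (m i).natAbs) (by simp) (Finset.mem_univ i)).trans
    (Finset.single_le_sum (f := fun m : Fin r → ℤ => ∑ i, (m i).natAbs) (by simp) hm)

theorem ExponentsLE.mono {f : Laurent r} {D E : ℕ} (h : ExponentsLE f D) (hDE : D ≤ E) :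
    ExponentsLE f E :=
  fun m hm i => (h m hm i).trans (by exact_mod_cast hDE)

theorem exponentsLE_single (m : Fin r → ℤ) (c : ℂ) {D : ℕ} (h : ∀ i, |m i| ≤ (D : ℤ)) :
    ExponentsLE (AddMonoidAlgebra.single m c) D := by
  classical
  intro n hn i
  have := Finsupp.support_single_subset hn
  simp only [Finset.mem_singleton] at this
  rw [this]
  exact h i

theorem exponentsLE_algebraMap (c : ℂ) (D : ℕ) :
    ExponentsLE (algebraMap ℂ (Laurent r) c) D :=
  exponentsLE_single 0 c (by simp)

theorem exponentsLE_one (D : ℕ) : ExponentsLE (1 : Laurent r) D :=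
  exponentsLE_single 0 1 (by simp)

theorem ExponentsLE.add {f g : Laurent r} {D : ℕ} (hf : ExponentsLE f D) (hg : ExponentsLE g D) :
    ExponentsLE (f + g) D := by
  classical
  intro m hm
  rcases Finset.mem_union.1 (Finsupp.support_add hm) with h | h
  exacts [hf m h, hg m h]

theorem ExponentsLE.mul {f g : Laurent r} {D E : ℕ} (hf : ExponentsLE f D)
    (hg : ExponentsLE g E) : ExponentsLE (f * g) (D + E) := by
  classical
  intro m hm i
  obtain ⟨p, hp, q, hq, rfl⟩ :=
    Finset.mem_add.1 (AddMonoidAlgebra.support_coeff_mul_subset f g hm)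
  push_cast
  exact (abs_add_le _ _).trans (add_le_add (hf p hp i) (hg q hq i))

theorem ExponentsLE.pow {f : Laurent r} {D : ℕ} (hf : ExponentsLE f D) (n : ℕ) :
    ExponentsLE (f ^ n) (n * D) := by
  induction n with
  | zero => simpa using exponentsLE_one _
  | succ n ih => simpa [pow_succ, Nat.succ_mul] using ih.mul hf

theorem exponentsLE_prod {ι : Type*} (s : Finset ι) (f : ι → Laurent r) {D : ℕ}
    (hf : ∀ k ∈ s, ExponentsLE (f k) D) : ExponentsLE (∏ k ∈ s, f k) (s.card * D) := by
  classical
  induction s using Finset.induction_on with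
  | empty => simpa using exponentsLE_one _
  | insert k s hk ih =>
    rw [Finset.prod_insert hk, Finset.card_insert_of_notMem hk, Nat.succ_mul, add_comm]
    exact (hf k (by simp)).mul (ih fun j hj => hf j (by simp [hj]))

theorem exponentsLE_sum {ι : Type*} (s : Finset ι) (f : ι → Laurent r) {D : ℕ}
    (hf : ∀ k ∈ s, ExponentsLE (f k) D) : ExponentsLE (∑ k ∈ s, f k) D := by
  classical
  induction s using Finset.induction_on with
  | empty => intro m hm; simp at hm
  | insert k s hk ih =>
    rw [Finset.sum_insert hk]
    exact (hf k (by simp)).add (ih fun j hj => hf j (by simp [hj]))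

theorem ExponentsLE.subst_const_mul_X {f : Laurent r} {D : ℕ} (hf : ExponentsLE f D)
    (t : Fin r → ℂˣ) : ExponentsLE (subst (fun i => const (t i) * X i) f : Laurent r) D := by
  conv => arg 1; rw [← AddMonoidAlgebra.sum_coeff_single f]
  simp only [Finsupp.sum, map_sum, subst_const_mul_X_single]
  exact exponentsLE_sum _ _ fun m hm => exponentsLE_single _ _ (hf m hm)

theorem ExponentsLE.card_support_le {f : Laurent r} {D : ℕ} (hf : ExponentsLE f D) :
    f.coeff.support.card ≤ (2 * D + 1) ^ r := by
  classical
  have : f.coeff.support ⊆ Fintype.piFinset fun _ => Finset.Icc (-(D : ℤ)) D := by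
    intro m hm
    simp only [Fintype.mem_piFinset, Finset.mem_Icc]
    exact fun i => abs_le.1 (hf m hm i)
  refine (Finset.card_le_card this).trans (le_of_eq ?_)
  simp only [Fintype.card_piFinset, Int.card_Icc, Finset.prod_const, Finset.card_univ,
    Fintype.card_fin]
  congr 1
  omega

/-- There are `n ^ r` factors, each in the box of `f`. Only the polynomial growth in `n` matters. -/
theorem ExponentsLE.cyclicResultant {f : Laurent r} {D : ℕ} (hf : ExponentsLE f D) (n : ℕ) :
    ExponentsLE (cyclicResultant n f) (n ^ r * D) := by
  have := exponentsLE_prod Finset.univ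
    (fun k : Fin r → Fin n => (subst (fun i => const (rootUnit n (k i)) * X i) f : Laurent r))
    fun k _ => hf.subst_const_mul_X _
  simpa [Amoeba.cyclicResultant] using this

/-! ### Averages over torsion points -/

theorem rootUnit_eq_pow (n k : ℕ) : (rootUnit n k : ℂ) = (rootUnit n 1 : ℂ) ^ k := by
  simp only [rootUnit, Units.val_mk0, ← Complex.exp_nat_mul]
  congr 1
  push_cast
  ring

theorem isPrimitiveRoot_rootUnit {n : ℕ} (hn : n ≠ 0) : IsPrimitiveRoot (rootUnit n 1 : ℂ) n := by
  simpa [rootUnit] using Complex.isPrimitiveRoot_exp n hn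

theorem norm_rootUnit (n k : ℕ) : ‖(rootUnit n k : ℂ)‖ = 1 := by
  rcases eq_or_ne n 0 with rfl | hn
  · simp [rootUnit]
  · rw [rootUnit_eq_pow, norm_pow, (isPrimitiveRoot_rootUnit hn).norm'_eq_one hn, one_pow]

/-- This is a geometric sum. The bound on `m` excludes the nonzero multiples of `n`, at which the
sum would also equal `n`. -/
theorem sum_rootUnit_zpow {n : ℕ} (m : ℤ) (hm : |m| < n) :
    ∑ k : Fin n, (rootUnit n k : ℂ) ^ m = if m = 0 then (n : ℂ) else 0 := by
  split_ifs with h0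
  · simp [h0]
  have hn : n ≠ 0 := by rintro rfl; simp at hm; exact absurd hm (abs_nonneg m).not_gt
  have hζ := isPrimitiveRoot_rootUnit hn
  have h1 : (rootUnit n 1 : ℂ) ^ m ≠ 1 := by
    rw [Ne, hζ.zpow_eq_one_iff_dvd]
    exact fun h => h0 (Int.eq_zero_of_abs_lt_dvd h hm)
  have : ∀ k : Fin n, (rootUnit n k : ℂ) ^ m = ((rootUnit n 1 : ℂ) ^ m) ^ (k : ℕ) := by
    intro k
    rw [rootUnit_eq_pow, ← zpow_natCast, ← zpow_mul, mul_comm, zpow_mul, zpow_natCast]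
  simp only [this]
  rw [Fin.sum_univ_eq_sum_range (fun k => ((rootUnit n 1 : ℂ) ^ m) ^ k) n, geom_sum_eq h1,
    ← zpow_natCast, ← zpow_mul, mul_comm, zpow_mul, zpow_natCast, hζ.pow_eq_one]
  simp

/-- Summing over the translates of a point by the `n`-torsion picks out the constant coefficient of
a Laurent polynomial whose exponents are smaller than `n`. -/
theorem sum_subst_rootUnit_mul {f : Laurent r} {D n : ℕ} (hf : ExponentsLE f D) (hD : D < n)
    (z : Fin r → ℂˣ) :
    ∑ k : Fin r → Fin n, subst (fun i => rootUnit n (k i) * z i) f = (n : ℂ) ^ r * f.coeff 0 := by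
  classical
  simp only [subst_eq_sum, Units.val_mul, mul_zpow, Finset.prod_mul_distrib]
  rw [Finset.sum_comm]
  have key : ∀ m ∈ f.coeff.support,
      ∑ k : Fin r → Fin n, f.coeff m *
        ((∏ i, (rootUnit n (k i) : ℂ) ^ m i) * ∏ i, (z i : ℂ) ^ m i) =
      if m = 0 then (n : ℂ) ^ r * f.coeff 0 else 0 := by
    intro m hm
    rw [← Finset.mul_sum, ← Finset.sum_mul,
      ← Fintype.prod_sum (fun i (k : Fin n) => (rootUnit n k : ℂ) ^ m i)]
    simp only [fun i => sum_rootUnit_zpow (n := n) (m i)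
      ((hf m hm i).trans_lt (by exact_mod_cast hD))]
    split_ifs with h
    · simp [h, mul_comm]
    · obtain ⟨i, hi⟩ := Function.ne_iff.1 h
      rw [Finset.prod_eq_zero (Finset.mem_univ i) (if_neg hi)]
      simp
  rw [Finset.sum_congr rfl key, Finset.sum_ite_eq']
  split_ifs with h
  · rfl
  · simp [Finsupp.notMem_support_iff.1 h]

/-! ### The fibre of `Log` over a point -/

theorem Log_eq_iff {z : Fin r → ℂˣ} {a : Fin r → ℝ} :
    Log z = a ↔ ∀ i, ‖(z i : ℂ)‖ = Real.exp (a i) := by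
  refine funext_iff.trans (forall_congr' fun i => ?_)
  rw [Log, ← Real.exp_eq_exp, Real.exp_log (norm_pos_iff.2 (z i).ne_zero)]

theorem Log_rootUnit_mul {z : Fin r → ℂˣ} {a : Fin r → ℝ} (hz : Log z = a) (n : ℕ)
    (k : Fin r → Fin n) : Log (fun i => rootUnit n (k i) * z i) = a := by
  rw [Log_eq_iff] at hz ⊢
  intro i
  rw [Units.val_mul, norm_mul, norm_rootUnit, one_mul, hz]

/-- Cauchy's estimate: the monomials of a Laurent polynomial are bounded on a fibre of `Log` by any
bound of the Laurent polynomial itself. -/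
theorem norm_coeff_mul_le {g : Laurent r} {a : Fin r → ℝ} {ε : ℝ}
    (h : ∀ z, Log z = a → ‖subst z g‖ ≤ ε) (m : Fin r → ℤ) :
    ‖g.coeff m‖ * ∏ i, Real.exp (a i) ^ m i ≤ ε := by
  -- Dividing by `z ^ m` moves the coefficient at `m` to the constant term, which averaging over
  -- torsion points extracts.
  set f : Laurent r := AddMonoidAlgebra.single (-m) 1 * g with hf
  have hcoeff : f.coeff 0 = g.coeff m := by
    rw [hf, AddMonoidAlgebra.coeff_single_mul_apply]
    simp
  have hpos : 0 < ∏ i, Real.exp (a i) ^ m i :=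
    Finset.prod_pos fun i _ => zpow_pos (Real.exp_pos _) _
  have hbound : ∀ z, Log z = a → ‖subst z f‖ ≤ ε / ∏ i, Real.exp (a i) ^ m i := by
    intro z hz
    rw [le_div_iff₀ hpos, hf, map_mul, subst_single, norm_mul]
    have : ‖(1 : ℂ) • ((∏ i, z i ^ (-m) i : ℂˣ) : ℂ)‖ = (∏ i, Real.exp (a i) ^ m i)⁻¹ := by
      simp [Log_eq_iff.1 hz]
    rw [this, mul_comm, ← mul_assoc, mul_inv_cancel₀ hpos.ne', one_mul]
    exact h z hz
  obtain ⟨D, hD⟩ := exists_exponentsLE f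
  let w : Fin r → ℂˣ := fun i => Units.mk0 (Real.exp (a i) : ℂ) (by simp [Complex.exp_ne_zero])
  have hw : Log w = a := by
    rw [Log_eq_iff]
    intro i
    simp [w]
  have hsum := sum_subst_rootUnit_mul hD (Nat.lt_succ_self D) w
  have hn : (0 : ℝ) < ((D.succ : ℕ) : ℝ) ^ r := by positivity
  have hle := norm_sum_le_of_le Finset.univ
    fun (k : Fin r → Fin D.succ) _ => hbound _ (Log_rootUnit_mul hw D.succ k)
  rw [hsum, hcoeff] at hle
  simp only [Finset.sum_const, Finset.card_univ, Fintype.card_fun, Fintype.card_fin, nsmul_eq_mul,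
    norm_mul, norm_pow, Complex.norm_natCast, Nat.cast_pow] at hle
  rw [← le_div_iff₀ hpos]
  exact le_of_mul_le_mul_left hle hn

/-! ### Cyclic resultants on a fibre of `Log`. -/

theorem subst_cyclicResultant (n : ℕ) (p : Laurent r) (z : Fin r → ℂˣ) :
    subst z (cyclicResultant n p) =
      ∏ k : Fin r → Fin n, subst (fun i => rootUnit n (k i) * z i) p := by
  simp only [cyclicResultant, map_prod, subst_subst_const_mul_X]

/-- The sum of `log p` over the `n`-torsion translates of a point of a fibre of `Log` is constant up
to an exponentially small error. -/
theorem exists_abs_sum_log_sub_le {p : Laurent r} {a : Fin r → ℝ} {α β : ℝ} {D n J : ℕ}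
    (hα : 0 < α) (hβ : 0 < β) (hp : ExponentsLE p D)
    (hval : ∀ z, Log z = a → ∃ x : ℝ, α ≤ x ∧ x ≤ β ∧ subst z p = x) (hJ : J * D < n) :
    ∃ L : ℝ, ∀ z, Log z = a →
      |∑ k : Fin r → Fin n, Real.log (subst (fun i => rootUnit n (k i) * z i) p).re - L| ≤
        n ^ r * ((1 - α / β) ^ (J + 1) / (1 - (1 - α / β))) := by
  -- `u = 1 - p / β` takes values in `[0, 1 - α / β]` on the fibre, so the series of `log (1 - u)`
  -- converges geometrically.
  set u : Laurent r := algebraMap ℂ (Laurent r) 1 + algebraMap ℂ (Laurent r) (-(β : ℂ)⁻¹) * p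
    with hu_def
  have hu : ExponentsLE u D := (exponentsLE_algebraMap _ _).add
    (by simpa using (exponentsLE_algebraMap (-(β : ℂ)⁻¹) 0).mul hp)
  -- `L` is the sum over translates of `log β` plus the series of `log (1 - u)` cut after `J` terms;
  -- `J * D < n` makes it independent of `z`.
  refine ⟨n ^ r * Real.log β -
    ∑ j ∈ Finset.range J, n ^ r * ((u ^ (j + 1)).coeff 0).re / (j + 1), fun z hz => ?_⟩
  have hval' := fun k : Fin r → Fin n => hval _ (Log_rootUnit_mul hz n k)
  choose x hxα hxβ hx using hval'
  set y : (Fin r → Fin n) → ℝ := fun k => 1 - x k / β with hy_def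
  have hy0 : ∀ k, 0 ≤ y k := fun k => sub_nonneg.2 ((div_le_one hβ).2 (hxβ k))
  have hyρ : ∀ k, y k ≤ 1 - α / β := fun k =>
    sub_le_sub_left (div_le_div_of_nonneg_right (hxα k) hβ.le) 1
  have hρ : 1 - α / β < 1 := by have := div_pos hα hβ; linarith
  have hsubst : ∀ k, subst (fun i => rootUnit n (k i) * z i) u = (y k : ℂ) := by
    intro k
    simp only [hu_def, map_add, map_mul, AlgHom.commutes, hx k, hy_def]
    simp
    ring
  have hpow : ∀ j ∈ Finset.range J, ∑ k, y k ^ (j + 1) = n ^ r * ((u ^ (j + 1)).coeff 0).re := by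
    intro j hj
    have hlt : (j + 1) * D < n :=
      (Nat.mul_le_mul_right D (Finset.mem_range.1 hj)).trans_lt hJ
    have := congrArg Complex.re (sum_subst_rootUnit_mul (hu.pow (j + 1)) hlt z)
    simp only [map_pow, hsubst, ← Complex.ofReal_pow, ← Complex.ofReal_sum, Complex.ofReal_re,
      ← Complex.ofReal_natCast, Complex.re_ofReal_mul] at this
    exact this
  have hlog : ∀ k, Real.log (x k) = Real.log β + Real.log (1 - y k) := by
    intro k
    have h0 : 0 < x k := hα.trans_le (hxα k)
    rw [← Real.log_mul hβ.ne' (by simp [hy_def, h0.ne', hβ.ne'])]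
    congr 1
    simp only [hy_def]
    field_simp
    ring
  have hsum : ∑ k : Fin r → Fin n, Real.log (subst (fun i => rootUnit n (k i) * z i) p).re -
      (n ^ r * Real.log β - ∑ j ∈ Finset.range J, n ^ r * ((u ^ (j + 1)).coeff 0).re / (j + 1)) =
      ∑ k, ((∑ j ∈ Finset.range J, y k ^ (j + 1) / (j + 1)) + Real.log (1 - y k)) := by
    simp only [hx, Complex.ofReal_re, hlog, Finset.sum_add_distrib]
    rw [Finset.sum_comm]
    have hpow' : ∀ j ∈ Finset.range J, ∑ k, y k ^ (j + 1) / (j + 1 : ℝ) =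
        n ^ r * ((u ^ (j + 1)).coeff 0).re / (j + 1) := fun j hj => by
      rw [← Finset.sum_div, hpow j hj]
    rw [Finset.sum_congr rfl hpow']
    simp only [Finset.sum_const, Finset.card_univ, Fintype.card_fun, Fintype.card_fin,
      nsmul_eq_mul, Nat.cast_pow]
    ring
  rw [hsum]
  refine (Finset.abs_sum_le_sum_abs _ _).trans ?_
  have hle : ∀ k ∈ Finset.univ,
      |(∑ j ∈ Finset.range J, y k ^ (j + 1) / (j + 1)) + Real.log (1 - y k)| ≤
      (1 - α / β) ^ (J + 1) / (1 - (1 - α / β)) := by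
    intro k _
    have h1 : |y k| < 1 := by rw [abs_of_nonneg (hy0 k)]; exact (hyρ k).trans_lt hρ
    refine (Real.abs_log_sub_add_sum_range_le h1 J).trans ?_
    rw [abs_of_nonneg (hy0 k)]
    exact div_le_div₀ (pow_nonneg ((hy0 k).trans (hyρ k)) _)
      (pow_le_pow_left₀ (hy0 k) (hyρ k) _) (by linarith) (by linarith [hyρ k])
  refine (Finset.sum_le_card_nsmul _ _ _ hle).trans (le_of_eq ?_)
  simp

/-- On a fibre of `Log`, the cyclic resultants of a positive Laurent polynomial are constant up to
an exponentially small relative error. -/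
theorem exists_norm_cyclicResultant_sub_le {p : Laurent r} {a : Fin r → ℝ} {α β : ℝ} {D n J : ℕ}
    (hα : 0 < α) (hβ : 0 < β) (hp : ExponentsLE p D)
    (hval : ∀ z, Log z = a → ∃ x : ℝ, α ≤ x ∧ x ≤ β ∧ subst z p = x) (hJ : J * D < n)
    (hsmall : n ^ r * ((1 - α / β) ^ (J + 1) / (1 - (1 - α / β))) ≤ 1) :
    ∃ M : ℝ, 0 < M ∧ ∀ z, Log z = a → ‖subst z (cyclicResultant n p) - (M : ℂ)‖ ≤
      M * (2 * (n ^ r * ((1 - α / β) ^ (J + 1) / (1 - (1 - α / β))))) := by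
  obtain ⟨L, hL⟩ := exists_abs_sum_log_sub_le hα hβ hp hval hJ
  refine ⟨Real.exp L, Real.exp_pos L, fun z hz => ?_⟩
  have hz' := hL z hz
  have hval' := fun k : Fin r → Fin n => hval _ (Log_rootUnit_mul hz n k)
  choose x hxα hxβ hx using hval'
  rw [subst_cyclicResultant]
  simp only [hx, Complex.ofReal_re] at hz' ⊢
  have hprod : ∏ k, x k = Real.exp L * Real.exp (∑ k, Real.log (x k) - L) := by
    rw [← Real.exp_add, add_sub_cancel, Real.exp_sum]
    exact Finset.prod_congr rfl fun k _ => (Real.exp_log (hα.trans_le (hxα k))).symm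
  rw [← Complex.ofReal_prod, ← Complex.ofReal_sub, Complex.norm_real, hprod, Real.norm_eq_abs,
    ← mul_sub_one, abs_mul, Real.abs_exp]
  refine mul_le_mul_of_nonneg_left ?_ (Real.exp_pos L).le
  -- The factor 2 comes from `|e^x - 1| ≤ 2|x|`, valid for `|x| ≤ 1`; hence the smallness
  -- hypothesis.
  exact (Real.abs_exp_sub_one_le (hz'.trans hsmall)).trans (by linarith)

/-! ### Lopsidedness -/

theorem termList_pos {f : Laurent r} {a : Fin r → ℝ} {c : ℝ} (hc : c ∈ termList f a) : 0 < c := by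
  obtain ⟨m, hm, rfl⟩ := Multiset.mem_map.1 hc
  exact mul_pos (norm_pos_iff.2 (Finsupp.mem_support_iff.1 hm))
    (Finset.prod_pos fun i _ => zpow_pos (Real.exp_pos _) _)

theorem IsSuperlopsided.isLopsided {S : Multiset ℝ} (hS : ∀ c ∈ S, 0 < c)
    (h : IsSuperlopsided S) : IsLopsided S := by
  obtain ⟨b, T, rfl, hT⟩ := h
  refine ⟨b, T, rfl, ?_⟩
  -- For a single entry `b`, lopsidedness says `0 < b`, which is where positivity enters. Otherwise,
  -- sum the inequalities over `T` and cancel its cardinality.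
  rcases eq_or_ne T 0 with rfl | h0
  · simpa using hS b
  have hcard : (0 : ℝ) < Multiset.card T := by exact_mod_cast Multiset.card_pos.2 h0
  have hlt := Multiset.sum_lt_sum_of_nonempty (f := fun c => (Multiset.card T : ℝ) * c)
    (g := fun _ => b) h0 hT
  rw [Multiset.sum_map_mul_left, Multiset.map_id', Multiset.map_const', Multiset.sum_replicate,
    nsmul_eq_mul] at hlt
  exact lt_of_mul_lt_mul_left hlt hcard.le

theorem not_isLopsided_of_subst_eq_zero {g : Laurent r} {z : Fin r → ℂˣ} (h : subst z g = 0) :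
    ¬ IsLopsided (termList g (Log z)) := by
  classical
  rintro ⟨b, T, hST, hT⟩
  have hb : b ∈ termList g (Log z) := hST ▸ Multiset.mem_cons_self b T
  obtain ⟨m, hm, rfl⟩ := Multiset.mem_map.1 hb
  have hcons : g.coeff.support.val = m ::ₘ (g.coeff.support.erase m).val := by
    rw [Finset.erase_val, Multiset.cons_erase hm]
  have hTeq := hST
  rw [termList, hcons, Multiset.map_cons, Multiset.cons_inj_right] at hTeq
  rw [← hTeq] at hT
  change ∑ n ∈ g.coeff.support.erase m, ‖g.coeff n‖ * ∏ i, Real.exp (Log z i) ^ n i < _ at hT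
  have hnorm : ∀ n : Fin r → ℤ, ‖g.coeff n‖ * ∏ i, Real.exp (Log z i) ^ n i =
      ‖g.coeff n * ∏ i, (z i : ℂ) ^ n i‖ := by
    intro n
    simp [Log_eq_iff.1 (rfl : Log z = Log z)]
  simp only [hnorm] at hT
  rw [subst_eq_sum, ← Finset.add_sum_erase _ _ hm] at h
  rw [eq_neg_of_add_eq_zero_left h, norm_neg] at hT
  exact (norm_sum_le _ _).not_gt hT

/-- A Laurent polynomial that is close to a constant on a fibre of `Log` has a superlopsided list of
monomials. -/
theorem isSuperlopsided_of_norm_sub_le {g : Laurent r} {a : Fin r → ℝ} {M δ : ℝ} {D : ℕ}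
    (hM : 0 < M) (hg : ExponentsLE g D)
    (h : ∀ z, Log z = a → ‖subst z g - (M : ℂ)‖ ≤ M * δ)
    (hδ : (((2 * D + 1) ^ r : ℕ) + 1 : ℝ) * δ < 1) : IsSuperlopsided (termList g a) := by
  classical
  -- Cauchy's estimate for `g - M` bounds all nonconstant monomials of `g` by `M * δ` and keeps its
  -- constant coefficient within `M * δ` of `M`.
  have hbound := norm_coeff_mul_le (g := g - algebraMap ℂ (Laurent r) (M : ℂ)) (a := a)
    (ε := M * δ) (by
      intro z hz
      rw [map_sub, AlgHom.commutes]
      exact h z hz)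
  have hconst : ∀ m : Fin r → ℤ, (g - algebraMap ℂ (Laurent r) (M : ℂ)).coeff m =
      g.coeff m - if m = 0 then (M : ℂ) else 0 := by
    intro m
    simp [sub_eq_add_neg, Finsupp.single_apply, eq_comm]
  have hδ0 : 0 ≤ M * δ := (by positivity : (0 : ℝ) ≤ _).trans (hbound 0)
  have hδ0' : 0 ≤ δ := nonneg_of_mul_nonneg_right hδ0 hM
  have h0 : M - M * δ ≤ ‖g.coeff 0‖ := by
    have := hbound 0
    rw [hconst] at this
    simp only [Pi.zero_apply, zpow_zero, Finset.prod_const_one, mul_one, if_true] at this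
    have h2 := norm_sub_norm_le (M : ℂ) (g.coeff 0)
    rw [norm_sub_rev, Complex.norm_real, Real.norm_eq_abs, abs_of_pos hM] at h2
    linarith
  set Q : ℝ := (((2 * D + 1) ^ r : ℕ) : ℝ) with hQ
  have hQ0 : 0 ≤ Q := by positivity
  have hδM : Q * (M * δ) < M - M * δ := by nlinarith
  have hmem : (0 : Fin r → ℤ) ∈ g.coeff.support := by
    rw [Finsupp.mem_support_iff, ← norm_pos_iff]
    have : 0 ≤ Q * (M * δ) := mul_nonneg hQ0 hδ0
    linarith
  have hcons : g.coeff.support.val = 0 ::ₘ (g.coeff.support.erase 0).val := by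
    rw [Finset.erase_val, Multiset.cons_erase hmem]
  refine ⟨_, _, by rw [termList, hcons, Multiset.map_cons], fun c hc => ?_⟩
  obtain ⟨m, hm, rfl⟩ := Multiset.mem_map.1 hc
  have hm0 : m ≠ 0 := Finset.ne_of_mem_erase hm
  have hmle := hbound m
  rw [hconst, if_neg hm0, sub_zero] at hmle
  have hcard : (Multiset.card ((g.coeff.support.erase 0).val.map fun m =>
      ‖g.coeff m‖ * ∏ i, Real.exp (a i) ^ m i) : ℝ) ≤ Q := by
    rw [Multiset.card_map, hQ, Nat.cast_le]
    exact (Finset.card_le_card (Finset.erase_subset _ _)).trans hg.card_support_le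
  simp only [Pi.zero_apply, zpow_zero, Finset.prod_const_one, mul_one]
  refine lt_of_le_of_lt ?_ (hδM.trans_le h0)
  exact mul_le_mul hcard hmle (termList_pos (f := g) (a := a)
    (Multiset.mem_map.2 ⟨m, Finset.mem_of_mem_erase hm, rfl⟩)).le hQ0

/-- The cyclic resultants of a Laurent polynomial that is positive on a fibre of `Log` are
eventually superlopsided there. -/
theorem eventually_isSuperlopsided_cyclicResultant {p : Laurent r} {a : Fin r → ℝ} {α β : ℝ}
    (hα : 0 < α) (hαβ : α ≤ β)
    (hval : ∀ z, Log z = a → ∃ x : ℝ, α ≤ x ∧ x ≤ β ∧ subst z p = x) :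
    ∀ᶠ n in Filter.atTop, IsSuperlopsided (termList (cyclicResultant n p) a) := by
  have hβ : 0 < β := hα.trans_le hαβ
  obtain ⟨D', hD'⟩ := exists_exponentsLE p
  -- A positive bound is needed in order to divide by `D` and take a `D`-th root.
  obtain ⟨D, hD0, hD⟩ : ∃ D : ℕ, 0 < D ∧ ExponentsLE p D :=
    ⟨D' + 1, D'.succ_pos, hD'.mono D'.le_succ⟩
  set ρ : ℝ := 1 - α / β with hρ_def
  have hρ0 : 0 ≤ ρ := sub_nonneg.2 ((div_le_one hβ).2 hαβ)
  have hρ1 : ρ < 1 := by have := div_pos hα hβ; linarith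
  set σ : ℝ := ρ ^ ((D : ℝ)⁻¹) with hσ_def
  have hσ0 : 0 ≤ σ := Real.rpow_nonneg hρ0 _
  have hσ1 : σ < 1 := Real.rpow_lt_one hρ0 hρ1 (by positivity)
  have hσD : σ ^ D = ρ := Real.rpow_inv_natCast_pow hρ0 hD0.ne'
  -- `C` collects the factors free of `n`: `2 * (2 * D + 1) ^ r` from the monomial count `Q + 1`,
  -- and `2 / (1 - ρ)` from the relative error `2 * ε`.
  set C : ℝ := 2 * (2 * D + 1) ^ r * 2 / (1 - ρ) with hC
  have hlim : Filter.Tendsto (fun n : ℕ => C * ((n : ℝ) ^ (r * r + r) * σ ^ n)) Filter.atTop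
      (nhds 0) := by
    simpa using (tendsto_pow_const_mul_const_pow_of_abs_lt_one (r * r + r)
      (by rwa [abs_of_nonneg hσ0])).const_mul C
  filter_upwards [hlim.eventually (gt_mem_nhds one_pos), Filter.eventually_ge_atTop 1]
    with n hn hn1
  have hn1' : (1 : ℝ) ≤ n := by exact_mod_cast hn1
  -- The largest `J` with `J * D < n`; maximality gives `n ≤ D * (J + 1)`, hence `ρ ^ (J + 1) ≤ σ ^
  -- n`.
  set J := (n - 1) / D with hJ_def
  have hJ : J * D < n := by
    have := Nat.div_mul_le_self (n - 1) D
    rw [← hJ_def] at this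
    omega
  have hJ' : n ≤ D * (J + 1) := by
    have := Nat.lt_mul_div_succ (n - 1) hD0
    rw [← hJ_def] at this
    omega
  set ε : ℝ := n ^ r * (ρ ^ (J + 1) / (1 - ρ)) with hε
  have hε0 : 0 ≤ ε := mul_nonneg (by positivity) (div_nonneg (pow_nonneg hρ0 _) (by linarith))
  have hεle : ε ≤ n ^ r * (σ ^ n / (1 - ρ)) := by
    refine mul_le_mul_of_nonneg_left (div_le_div_of_nonneg_right ?_ (by linarith)) (by positivity)
    rw [← hσD, ← pow_mul]
    exact pow_le_pow_of_le_one hσ0 hσ1.le hJ'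
  set Q : ℝ := (((2 * (n ^ r * D) + 1) ^ r : ℕ) : ℝ) with hQ
  have hQ1 : 1 ≤ Q := by
    rw [hQ]
    exact_mod_cast Nat.one_le_pow _ _ (Nat.succ_pos _)
  have hQle : Q + 1 ≤ 2 * (2 * D + 1) ^ r * n ^ (r * r) := by
    have h1 : (1 : ℝ) ≤ (n : ℝ) ^ r := one_le_pow₀ hn1'
    have h2 : Q ≤ ((2 * D + 1) * n ^ r) ^ r := by
      rw [hQ]
      push_cast
      exact pow_le_pow_left₀ (by positivity) (by nlinarith) r
    rw [mul_pow, ← pow_mul] at h2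
    nlinarith
  have hfin : (Q + 1) * (2 * ε) < 1 := by
    refine lt_of_le_of_lt ?_ hn
    have h3 : (Q + 1) * (2 * ε) ≤
        (2 * (2 * D + 1) ^ r * n ^ (r * r)) * (2 * (n ^ r * (σ ^ n / (1 - ρ)))) :=
      mul_le_mul hQle (by linarith) (by positivity) (by positivity)
    refine h3.trans (le_of_eq ?_)
    rw [hC, pow_add]
    ring
  obtain ⟨M, hM, hM'⟩ := exists_norm_cyclicResultant_sub_le hα hβ hD hval hJ
    (show ε ≤ 1 by nlinarith)
  exact isSuperlopsided_of_norm_sub_le hM (hD.cyclicResultant n) hM' hfin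

/-! ### The sum of squares attached to generators of an ideal -/

theorem subst_conjCoeff (z w : Fin r → ℂˣ)
    (hw : ∀ i, (w i : ℂ) = (starRingEnd ℂ) (z i : ℂ)) (f : Laurent r) :
    subst w (conjCoeff f) = (starRingEnd ℂ) (subst z f) := by
  induction f using AddMonoidAlgebra.induction_linear with
  | zero => simp [conjCoeff]
  | add f g hf hg =>
    rw [map_add, map_add, ← hf, ← hg, ← map_add]
    simp [conjCoeff]
  | single m c => simp [conjCoeff, subst_single, hw]

/-- Since `|z_i| = e^{a_i}` on the fibre, `e^{2a_i} z_i⁻¹` is the complex conjugate of `z_i`, and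
each summand becomes `f_j(z)` times its conjugate. -/
theorem subst_sumOfSquares {k : ℕ} (f : Fin k → Laurent r) {a : Fin r → ℝ} {z : Fin r → ℂˣ}
    (hz : Log z = a) :
    subst z (sumOfSquares f a) = ((∑ j, ‖subst z (f j)‖ ^ 2 : ℝ) : ℂ) := by
  rw [sumOfSquares, map_sum, Complex.ofReal_sum]
  refine Finset.sum_congr rfl fun j _ => ?_
  rw [map_mul, map_subst, subst_conjCoeff z, Complex.mul_conj, Complex.normSq_eq_norm_sq]
  intro i
  rw [map_mul, map_inv, unitsMap_subst_X, unitsMap_subst_const, Units.val_mul,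
    Units.val_inv_eq_inv_val, Units.val_mk0, Complex.inv_def, Complex.normSq_eq_norm_sq,
    Log_eq_iff.1 hz i, ← Real.exp_nat_mul]
  push_cast
  rw [mul_left_comm, mul_inv_cancel₀ (Complex.exp_ne_zero _), mul_one]

/-! ### Membership in the ideal. -/

theorem sumOfSquares_mem {k : ℕ} (f : Fin k → Laurent r) (a : Fin r → ℝ) :
    sumOfSquares f a ∈ Ideal.span (Set.range f) :=
  Ideal.sum_mem _ fun j _ => Ideal.mul_mem_right _ _ (Ideal.subset_span ⟨j, rfl⟩)

theorem subst_X_eq_self (p : Laurent r) : subst (fun i => X i) p = p := by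
  have h := fun m c => subst_const_mul_X_single (r := r) (fun _ => 1) m c
  have h1 : (const 1 : (Laurent r)ˣ) = 1 := map_one _
  simp only [h1, one_mul, Units.val_one, one_zpow, Finset.prod_const_one, mul_one] at h
  induction p using AddMonoidAlgebra.induction_linear with
  | zero => simp
  | add f g hf hg => rw [map_add, hf, hg]
  | single m c => exact h m c

/-- The factor with all `k_i = 0` is `p` itself. For `n = 0` and `r > 0` the product is empty and
equals 1. -/
theorem cyclicResultant_mem {I : Ideal (Laurent r)} {p : Laurent r} (hp : p ∈ I) {n : ℕ}
    (hn : n ≠ 0) : cyclicResultant n p ∈ I := by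
  classical
  have : NeZero n := ⟨hn⟩
  have h1 : rootUnit n ((0 : Fin n) : ℕ) = 1 := Units.ext (by simp [rootUnit])
  have h2 : (const 1 : (Laurent r)ˣ) = 1 := map_one _
  refine Ideal.mem_of_dvd _ (Finset.dvd_prod_of_mem _ (Finset.mem_univ fun _ => (0 : Fin n))) ?_
  simp only [h1, h2, one_mul, subst_X_eq_self]
  exact hp

/-! ### Compactness of the fibre and positivity of the sum of squares. -/

/-- The fibre of `Log` over `a`, parametrized by the real torus. -/
noncomputable def torusPoint (a : Fin r → ℝ) (θ : Fin r → Circle) (i : Fin r) : ℂˣ :=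
  Units.mk0 (Real.exp (a i) * θ i : ℂ) (mul_ne_zero (by simp) (θ i).coe_ne_zero)

theorem Log_torusPoint (a : Fin r → ℝ) (θ : Fin r → Circle) : Log (torusPoint a θ) = a := by
  rw [Log_eq_iff]
  intro i
  simpa [torusPoint] using Circle.norm_coe (θ i)

theorem exists_torusPoint_eq {a : Fin r → ℝ} {z : Fin r → ℂˣ} (hz : Log z = a) :
    ∃ θ, torusPoint a θ = z := by
  refine ⟨fun i => ⟨z i / Real.exp (a i), ?_⟩, funext fun i => Units.ext ?_⟩
  · rw [Submonoid.unitSphere, Submonoid.mem_mk, Subsemigroup.mem_mk, mem_sphere_zero_iff_norm, norm_div, Complex.norm_real, Log_eq_iff.1 hz i,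
      Real.norm_of_nonneg (Real.exp_pos _).le, div_self (Real.exp_pos _).ne']
  · have : (Real.exp (a i) : ℂ) ≠ 0 := by simp
    exact mul_div_cancel₀ _ this

theorem continuous_subst_torusPoint (a : Fin r → ℝ) (f : Laurent r) :
    Continuous fun θ => subst (torusPoint a θ) f := by
  simp only [subst_eq_sum]
  refine continuous_finsetSum _ fun m _ => continuous_const.mul
    (continuous_finsetProd _ fun i _ => Continuous.zpow₀ ?_ _ fun θ => Or.inl (Units.ne_zero _))
  simp only [torusPoint, Units.val_mk0]
  fun_prop

/-- The bounds are the extrema on the compact torus. A zero minimum would be a common zero of all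
the generators over `a`, putting `a` in the amoeba. -/
theorem exists_bounds_sumOfSquares {k : ℕ} (f : Fin k → Laurent r) {a : Fin r → ℝ}
    (ha : a ∉ amoeba (Ideal.span (Set.range f))) :
    ∃ α β : ℝ, 0 < α ∧ α ≤ β ∧
      ∀ z, Log z = a → ∃ x : ℝ, α ≤ x ∧ x ≤ β ∧ subst z (sumOfSquares f a) = x := by
  let P : (Fin r → Circle) → ℝ := fun θ => ∑ j, ‖subst (torusPoint a θ) (f j)‖ ^ 2
  have hP : Continuous P := continuous_finsetSum _ fun j _ =>
    (continuous_subst_torusPoint a (f j)).norm.pow 2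
  obtain ⟨θ₀, -, hmin⟩ := isCompact_univ.exists_isMinOn Set.univ_nonempty hP.continuousOn
  obtain ⟨θ₁, -, hmax⟩ := isCompact_univ.exists_isMaxOn Set.univ_nonempty hP.continuousOn
  refine ⟨P θ₀, P θ₁, ?_, hmin (Set.mem_univ _), fun z hz => ?_⟩
  · refine lt_of_le_of_ne (Finset.sum_nonneg fun j _ => sq_nonneg _) fun h0 => ha ?_
    have hzero := (Finset.sum_eq_zero_iff_of_nonneg fun j _ => sq_nonneg _).1 h0.symm
    refine ⟨torusPoint a θ₀, fun g hg => ?_, Log_torusPoint a θ₀⟩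
    have hle : Ideal.span (Set.range f) ≤ RingHom.ker (subst (torusPoint a θ₀)) := by
      rw [Ideal.span_le]
      rintro _ ⟨j, rfl⟩
      exact norm_eq_zero.1 (pow_eq_zero_iff two_ne_zero |>.1 (hzero j (Finset.mem_univ j)))
    exact hle hg
  · obtain ⟨θ, rfl⟩ := exists_torusPoint_eq hz
    exact ⟨P θ, hmin (Set.mem_univ _), hmax (Set.mem_univ _), subst_sumOfSquares f hz⟩

/-! ### Assembly of the theorem. -/

theorem eventually_cyclicResultant_sumOfSquares {I : Ideal (Laurent r)} {a : Fin r → ℝ}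
    (ha : a ∉ amoeba I) {k : ℕ} (f : Fin k → Laurent r) (hf : Ideal.span (Set.range f) = I) :
    ∃ N : ℕ, ∀ n : ℕ, N ≤ n →
      cyclicResultant n (sumOfSquares f a) ∈ I ∧
      IsLopsided (termList (cyclicResultant n (sumOfSquares f a)) a) ∧
      IsSuperlopsided (termList (cyclicResultant n (sumOfSquares f a)) a) := by
  subst hf
  obtain ⟨α, β, hα, hαβ, hval⟩ := exists_bounds_sumOfSquares f ha
  refine Filter.eventually_atTop.1 ?_
  filter_upwards [eventually_isSuperlopsided_cyclicResultant hα hαβ hval,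
    Filter.eventually_ne_atTop 0] with n hn hn0
  exact ⟨cyclicResultant_mem (sumOfSquares_mem f a) hn0,
    hn.isLopsided fun _ => termList_pos, hn⟩

/-- The two criteria come with no chosen generators; the Noetherian property supplies a finite
family to which the sum of squares applies. -/
theorem exists_span_range_eq (I : Ideal (Laurent r)) :
    ∃ (k : ℕ) (f : Fin k → Laurent r), Ideal.span (Set.range f) = I := by
  have : IsNoetherianRing (Laurent r) := Algebra.FiniteType.isNoetherianRing ℂ _
  exact Submodule.fg_iff_exists_fin_generating_family.1 (IsNoetherian.noetherian I)

end Amoeba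

theorem theorem5p3 (r : ℕ) (I : Ideal (Amoeba.Laurent r)) (a : Fin r → ℝ) :
    (a ∈ Amoeba.amoeba I ↔ ∀ g ∈ I, ¬ Amoeba.IsLopsided (Amoeba.termList g a)) ∧
    (a ∈ Amoeba.amoeba I ↔ ∀ g ∈ I, ¬ Amoeba.IsSuperlopsided (Amoeba.termList g a)) ∧
    (a ∉ Amoeba.amoeba I →
      ∀ (k : ℕ) (f : Fin k → Amoeba.Laurent r), Ideal.span (Set.range f) = I →
        ∃ N : ℕ, ∀ n : ℕ, N ≤ n →
          Amoeba.cyclicResultant n (Amoeba.sumOfSquares f a) ∈ I ∧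
          Amoeba.IsLopsided
            (Amoeba.termList (Amoeba.cyclicResultant n (Amoeba.sumOfSquares f a)) a) ∧
          Amoeba.IsSuperlopsided
            (Amoeba.termList (Amoeba.cyclicResultant n (Amoeba.sumOfSquares f a)) a)) := by
  have hlop : a ∈ Amoeba.amoeba I → ∀ g ∈ I, ¬ Amoeba.IsLopsided (Amoeba.termList g a) := by
    rintro ⟨z, hz, rfl⟩ g hg
    exact Amoeba.not_isLopsided_of_subst_eq_zero (hz g hg)
  have hres : a ∉ Amoeba.amoeba I → ∃ g ∈ I, Amoeba.IsLopsided (Amoeba.termList g a) ∧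
      Amoeba.IsSuperlopsided (Amoeba.termList g a) := by
    intro ha
    obtain ⟨k, f, hf⟩ := Amoeba.exists_span_range_eq I
    obtain ⟨N, hN⟩ := Amoeba.eventually_cyclicResultant_sumOfSquares ha f hf
    exact ⟨_, hN N le_rfl⟩
  refine ⟨⟨hlop, fun h => ?_⟩, ⟨fun ha g hg hs => hlop ha g hg
    (hs.isLopsided fun _ => Amoeba.termList_pos), fun h => ?_⟩,
    fun ha k f hf => Amoeba.eventually_cyclicResultant_sumOfSquares ha f hf⟩
  · by_contra ha
    obtain ⟨g, hg, h1, -⟩ := hres ha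
    exact h g hg h1
  · by_contra ha
    obtain ⟨g, hg, -, h2⟩ := hres ha
    exact h g hg h2
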